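/- **Theorem 0.1.** Let $\mathcal V$ be an algebra of differential functions in one variable $u$, i.e. a (commutative) domain containing $\mathbb C[x,u,u',u'',\dots]$, with $u^{(0)}=u$, $u^{(1)}=u'$, etc., such that the partial derivatives $\partial/\partial x$, $\partial/\partial u^{(n)}$ $(n\ge 0)$ extend to commuting derivations of $\mathcal V$ and, for each $f\in\mathcal V$, only finitely many $\partial f/\partial u^{(n)}$ are nonzero. Let $D=\frac{\partial}{\partial x}+\sum_{n\ge0}u^{(n+1)}\frac{\partial}{\partial u^{(n)}}$. Call $f\in\mathcal V$ a *quasiconstant* if $\partial f/\partial u^{(n)}=0$ for all $n$; let $\operatorname{ord} f$ be the largest $n$ with $\partial f/\partial u^{(n)}\neq0$ if $f$ is not a quasiconstant, and $\operatorname{ord}f=-\infty$ if it is. Let $N$ be a positive odd integer and $f_1,f_3,\dots,f_N\in\mathcal V$ with $f_N\ne0$. Let $$\{u_\lambda u\}=\sum_{1\le j\le N,\ j\ \mathrm{odd}}(D+2\lambda)^jf_j ,$$ extended to $\mathcal V$ by $$\{f_\lambda g\}=\sum_{m,n\ge0}\frac{\partial g}{\partial u^{(n)}}(D+\lambda)^n\{u_{D+\lambda}u\}_{\to}(-D-\lambda)^m\frac{\partial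 f}{\partial u^{(m)}},$$ where, if $\{u_\lambda u\}=\sum_k h_k\lambda^k$, then $\{u_{D+\lambda}u\}_{\to}=\sum_k h_k (D+\lambda)^k$. Suppose this is a Poisson $\lambda$-bracket of order $N$, i.e. it is $\mathbb C$-bilinear and satisfies, for all $a,b,c\in\mathcal V$, * sesquilinearity: $\{Da_\lambda b\}=-\lambda\{a_\lambda b\}$ and $\{a_\lambda Db\}=(D+\lambda)\{a_\lambda b\}$; * skewcommutativity: $\{b_\lambda a\}=-\sum_n(-\lambda-D)^nc_n$, where $\{a_\lambda b\}=\sum_nc_n\lambda^n$; * the Jacobi identity: $\{a_\lambda\{b_\mu c\}\}-\{b_\mu\{a_\lambda c\}\}=\{\{a_\lambda b\}_{\lambda+\mu}c\}$; * the Leibniz rule: $\{a_\lambda bc\}=\{a_\lambda b\}c+b\{a_\lambda c\}$. Suppose that not all $f_j$ are quasiconstants. Then the level $m=\max_j\,(j+\operatorname{ord}f_j)$, the maximum being over odd $j$ with $1\le j\le N$, is a non-negative integer satisfying $$\tfrac12(N-1)\le m\le 2N+1,\qquad m\neq 2N;$$ moreover $m\ne\frac12(N+1)$ if $N\equiv-1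 \pmod 4$, and $m\ne\frac12(N-1)$, $m\neq\frac12(N+3)$ if $N\equiv1\pmod 4$. -/

import Mathlib

open Polynomial

noncomputable section

/-! ## Poisson vertex algebras -/

section PVA

variable {V : Type*} [CommRing V] [Algebra ℂ V]

/-- The coefficientwise action of a derivation `D` of `V` on `V[λ]`: `∑ aₙ λⁿ ↦ ∑ (D aₙ) λⁿ`. -/
def coeffD (D : Derivation ℂ V V) : V[X] →ₗ[ℂ] V[X] :=
  Polynomial.lsum fun n => ((Polynomial.monomial n).restrictScalars ℂ) ∘ₗ D.toLinearMap

/-- The operator `D + q` on `V[λ]`: `D` acts coefficientwise and `q ∈ V[λ]` by multiplication.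
For instance `D + λ` is `addD D X` and `D + 2λ` is `addD D (2 * X)`. -/
def addD (D : Derivation ℂ V V) (q : V[X]) : Module.End ℂ V[X] :=
  coeffD D + LinearMap.mulLeft ℂ q

/-- Poisson `λ`-brackets on a differential algebra `(V, D)` over `ℂ`. The value `{a_λ b} ∈ V[λ]`
is `br a b`, the variable of the polynomial ring being `λ`. The Jacobi identity is
an identity in `V[λ][μ]`, in which `λ = C X` and `μ = X`. -/
structure IsPoissonLambdaBracket (D : Derivation ℂ V V) (br : V → V → V[X]) : Prop where
  add_left : ∀ a b c, br (a + b) c = br a c + br b c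
  add_right : ∀ a b c, br a (b + c) = br a b + br a c
  smul_left : ∀ (z : ℂ) (a b), br (z • a) b = z • br a b
  smul_right : ∀ (z : ℂ) (a b), br a (z • b) = z • br a b
  /-- `{Da_λ b} = -λ {a_λ b}` -/
  sesq_left : ∀ a b, br (D a) b = -X * br a b
  /-- `{a_λ Db} = (D + λ) {a_λ b}` -/
  sesq_right : ∀ a b, br a (D b) = addD D X (br a b)
  /-- `{b_λ a} = -∑ₙ (-λ - D)ⁿ cₙ`, where `{a_λ b} = ∑ₙ cₙ λⁿ` -/
  skew : ∀ a b, br b a = -((br a b).sum fun n c => ((-addD D X) ^ n) (C c))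
  /-- `{a_λ {b_μ c}} - {b_μ {a_λ c}} = {{a_λ b}_{λ+μ} c}` -/
  jacobi : ∀ a b c,
    ((br b c).sum fun k e => (X : V[X][X]) ^ k * aeval (C X : V[X][X]) (br a e))
      - ((br a c).sum fun k e => (C X : V[X][X]) ^ k * aeval (X : V[X][X]) (br b e))
      = (br a b).sum fun k e => (C X : V[X][X]) ^ k * aeval (C X + X : V[X][X]) (br e c)
  /-- `{a_λ bc} = {a_λ b} c + b {a_λ c}` -/
  leibniz : ∀ a b c, br a (b * c) = br a b * C c + C b * br a c

end PVA

/-! ## Algebras of differential functions in one variable -/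

/-- An algebra of differential functions in one differential variable `u`: a domain `V` containing
`ℂ[x, u, u', u'', …]`, with commuting derivations extending `∂/∂x` and the `∂/∂u⁽ⁿ⁾`,
such that for each `f` only finitely many `∂f/∂u⁽ⁿ⁾` are nonzero.
Polynomials in `x` and the `u⁽ⁿ⁾` are modelled by `MvPolynomial (Option ℕ) ℂ`: the variable
`none` is `x` and the variable `some n` is `u⁽ⁿ⁾`. -/
class DifferentialFunctions (V : Type*) [CommRing V] [IsDomain V] [Algebra ℂ V] where
  /-- the embedding of `ℂ[x, u, u', u'', …]` -/
  incl : MvPolynomial (Option ℕ) ℂ →ₐ[ℂ] V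
  incl_injective : Function.Injective incl
  /-- `∂/∂x` (for `none`) and `∂/∂u⁽ⁿ⁾` (for `some n`) -/
  partialD : Option ℕ → Derivation ℂ V V
  partialD_incl : ∀ i p, partialD i (incl p) = incl (MvPolynomial.pderiv i p)
  partialD_comm : ∀ i j f, partialD i (partialD j f) = partialD j (partialD i f)
  finite_support : ∀ f, {n : ℕ | partialD (some n) f ≠ 0}.Finite

namespace DifferentialFunctions

variable {V : Type*} [CommRing V] [IsDomain V] [Algebra ℂ V] [DifferentialFunctions V]

variable (V) in
/-- The element `u⁽ⁿ⁾`. -/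
def uvar (n : ℕ) : V := incl (MvPolynomial.X (some n))

/-- The derivation `∂/∂u⁽ⁿ⁾`. -/
def du (n : ℕ) : Derivation ℂ V V := partialD (some n)

/-- The finite set of those `n` for which `∂f/∂u⁽ⁿ⁾ ≠ 0`. -/
def duSupport (f : V) : Finset ℕ := (finite_support f).toFinset

theorem mem_duSupport (f : V) (n : ℕ) : n ∈ duSupport f ↔ du n f ≠ 0 := by
  simp [duSupport, du]

theorem sum_duSupport (f : V) (s : Finset ℕ) (h : duSupport f ⊆ s) :
    ∑ n ∈ duSupport f, uvar V (n + 1) * du n f = ∑ n ∈ s, uvar V (n + 1) * du n f := by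
  refine Finset.sum_subset h fun n _ hn => ?_
  rw [mem_duSupport, not_not] at hn
  rw [hn, mul_zero]

variable (V) in
/-- The total derivative `D = ∂/∂x + ∑ₙ u⁽ⁿ⁺¹⁾ ∂/∂u⁽ⁿ⁾`. -/
def totalD : Derivation ℂ V V :=
  Derivation.mk'
    { toFun := fun f =>
        partialD (none : Option ℕ) f + ∑ n ∈ duSupport f, uvar V (n + 1) * du n f
      map_add' := fun f g => by
        have hs := sum_duSupport (f + g) (duSupport (f + g) ∪ (duSupport f ∪ duSupport g))
          Finset.subset_union_left
        have hf := sum_duSupport f (duSupport (f + g) ∪ (duSupport f ∪ duSupport g))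
          (Finset.subset_union_left.trans Finset.subset_union_right)
        have hg := sum_duSupport g (duSupport (f + g) ∪ (duSupport f ∪ duSupport g))
          (Finset.subset_union_right.trans Finset.subset_union_right)
        rw [hs, hf, hg]
        simp only [map_add, mul_add, Finset.sum_add_distrib]
        ring
      map_smul' := fun z f => by
        have hs := sum_duSupport (z • f) (duSupport (z • f) ∪ duSupport f)
          Finset.subset_union_left
        have hf := sum_duSupport f (duSupport (z • f) ∪ duSupport f)
          Finset.subset_union_right
        rw [hs, hf]
        simp only [Derivation.map_smul, mul_smul_comm, RingHom.id_apply, smul_add,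
          Finset.smul_sum] }
    (fun f g => by
      have hs := sum_duSupport (f * g) (duSupport (f * g) ∪ (duSupport f ∪ duSupport g))
        Finset.subset_union_left
      have hf := sum_duSupport f (duSupport (f * g) ∪ (duSupport f ∪ duSupport g))
        (Finset.subset_union_left.trans Finset.subset_union_right)
      have hg := sum_duSupport g (duSupport (f * g) ∪ (duSupport f ∪ duSupport g))
        (Finset.subset_union_right.trans Finset.subset_union_right)
      simp only [LinearMap.coe_mk, AddHom.coe_mk]
      rw [hs, hf, hg]
      simp only [Derivation.leibniz, smul_eq_mul, mul_add, Finset.sum_add_distrib,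
        Finset.mul_sum]
      simp only [mul_left_comm]
      ring)

/-- The `λ`-bracket on `V` determined by `{u_λ u} = P`, where `P = ∑ₖ hₖ λᵏ`:
`{f_λ g} = ∑ₘ ∑ₙ (∂g/∂u⁽ⁿ⁾) (D+λ)ⁿ {u_{D+λ} u}_→ (-D-λ)ᵐ (∂f/∂u⁽ᵐ⁾)`,
in which `{u_{D+λ} u}_→` is the operator `∑ₖ hₖ (D+λ)ᵏ`. -/
def lambdaBracket (P : V[X]) (f g : V) : V[X] :=
  ∑ m ∈ duSupport f, ∑ n ∈ duSupport g,
    C (du n g) * ((addD (totalD V) X) ^ n)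
      (P.sum fun k h => C h * ((addD (totalD V) X) ^ k)
        (((-addD (totalD V) X) ^ m) (C (du m f))))

/-- The odd indices `1, 3, …` up to `N`. -/
def oddUpTo (N : ℕ) : Finset ℕ := (Finset.range (N + 1)).filter Odd

/-- `∑_{j odd, j ≤ N} (D + 2λ)ʲ f_j`. -/
def bracketUU (N : ℕ) (f : ℕ → V) : V[X] :=
  ∑ j ∈ oddUpTo N, ((addD (totalD V) (2 * X)) ^ j) (C (f j))

/-- `f` is a quasiconstant if all `∂f/∂u⁽ⁿ⁾` vanish. -/
def IsQuasiconstant (f : V) : Prop := ∀ n, du n f = 0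

/-- The differential order of `f`: the largest `n` with `∂f/∂u⁽ⁿ⁾ ≠ 0`, and `⊥` (i.e. `-∞`) for
a quasiconstant. -/
def ord (f : V) : WithBot ℕ := (duSupport f).max

/-- The level `max_j (j + ord f_j)`, over the odd `j ≤ N`; it is `⊥` if all `f_j` are
quasiconstants. -/
def level (N : ℕ) (f : ℕ → V) : WithBot ℕ :=
  (oddUpTo N).sup fun j => (j : WithBot ℕ) + ord (f j)

end DifferentialFunctions

end

/-! Take the Jacobi identity on u, u, u and keep its part of total degree N + m in λ, μ. Each f_j
enters only through s_j = ∂f_j/∂u⁽ᵐ⁻ʲ⁾, the operator (D + 2λ)ʲ becomes a power of a linear form, and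
with λ + μ + ν = 0 the identity says that the cyclic sum of ∑ s_j (μ - ν)ʲ λ^(N+m-j) vanishes
(`sum_symbolCoeff_mul_eq_zero`). By the choice of m some s_j is nonzero, so this cyclic sum must
have a kernel.

If the j that occur are at most an odd n and N + m = n + K, the kernel is trivial when K = 2n or K ≥
2n + 2 (`eq_zero_of_cyclic_sum_eq_zero`). On the line (1 + t, 1 - t, -2) the relation reads A(t) -
A(-t) + B(t) = 0 with (1 + t)^K dividing A and deg B ≤ n. Hence the derivative of A of order n + 1
is even; divisibility and degree force it to be c(1 - t²)^(n-1), with c = 0 for large K. It has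
constant sign because n is odd, and A vanishes to high order at -1 and again at 3, so A = 0.

The theorem follows by taking (n, K) to be (N, m), (m, N) or (m - 1, N + 1). -/

/-! ### Real polynomials: injectivity of the cyclic sum. -/

theorem Polynomial.iterate_derivative_comp_neg_X (p : ℝ[X]) (k : ℕ) :
    derivative^[k] (p.comp (-X)) = (-1) ^ k * (derivative^[k] p).comp (-X) := by
  induction k with
  | zero => simp
  | succ k ih =>
    rw [Function.iterate_succ_apply', ih, Function.iterate_succ_apply']
    have h : ((-1 : ℝ[X]) ^ k) = C ((-1) ^ k) := by simp
    rw [h, derivative_C_mul, derivative_comp, ← h]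
    simp
    ring

/-- A polynomial vanishing to order `> n` at `a` and whose derivative of order `n + 1` is
nonnegative on `[a, ∞)` vanishes as soon as it vanishes at a point `b > a`. -/
theorem Polynomial.eq_zero_of_iterate_derivative_nonneg {p : ℝ[X]} {n : ℕ} {a b : ℝ} (hab : a < b)
    (ha : ∀ i ≤ n, (derivative^[i] p).eval a = 0) (hb : p.eval b = 0)
    (hp : ∀ x, a ≤ x → 0 ≤ (derivative^[n + 1] p).eval x) : p = 0 := by
  have mono : ∀ q : ℝ[X], (∀ x, a ≤ x → 0 ≤ (derivative q).eval x) →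
      MonotoneOn (fun x => q.eval x) (Set.Ici a) := by
    intro q hq
    refine monotoneOn_of_deriv_nonneg (convex_Ici a) q.continuous.continuousOn
      q.differentiable.differentiableOn fun x hx => ?_
    rw [interior_Ici] at hx
    rw [Polynomial.deriv]
    exact hq x hx.le
  -- Integrate down from order n + 1: each lower derivative is nondecreasing and starts from 0 at a.
  have nonneg : ∀ i ≤ n, ∀ x, a ≤ x → 0 ≤ (derivative^[n + 1 - i] p).eval x := by
    intro i
    induction i with
    | zero => intro _ x hx; exact hp x hx
    | succ i ih =>
      intro hi x hx
      have h1 := mono (derivative^[n + 1 - (i + 1)] p) (by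
        intro y hy
        rw [← Function.iterate_succ_apply' (f := derivative)]
        have : (n + 1 - (i + 1)).succ = n + 1 - i := by omega
        rw [this]
        exact ih (by omega) y hy) Set.self_mem_Ici hx hx
      simp only [ha (n + 1 - (i + 1)) (by omega)] at h1
      exact h1
  have hmono := mono p (by
    intro x hx
    have h1 := nonneg n le_rfl x hx
    rwa [show n + 1 - n = 1 by omega] at h1)
  refine p.eq_zero_of_infinite_isRoot ((Set.Icc_infinite hab).mono fun x hx => ?_)
  have h1 := hmono Set.self_mem_Ici hx.1 hx.1
  have h2 := hmono hx.1 hab.le hx.2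
  have h3 : p.eval a = 0 := ha 0 (Nat.zero_le n)
  simp only [h3, hb] at h1 h2
  exact le_antisymm h2 h1

/-- Antisymmetrization over the symmetric group on `λ, μ, ν` with `λ + μ + ν = 0` is injective on
the span of the `(μ - ν) ^ j λ ^ (n + K - j)` with `j ≤ n` odd,
here restricted to the line `(λ, μ, ν) = (1 + t, 1 - t, -2)`. -/
theorem eq_zero_of_cyclic_sum_eq_zero {n K : ℕ} (hn : Odd n) (hK : K = 2 * n ∨ 2 * n + 2 ≤ K)
    (a : ℕ → ℝ) (ha : ∀ j, ¬ Odd j → a j = 0)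
    (h : ∀ t : ℝ, ∑ j ∈ Finset.range (n + 1), a j * ((3 - t) ^ j * (1 + t) ^ (n + K - j)
      - (3 + t) ^ j * (1 - t) ^ (n + K - j) + (2 * t) ^ j * (-2) ^ (n + K - j)) = 0) :
    ∀ j ≤ n, a j = 0 := by
  -- The first terms of the cyclic sum form A, the second ones A(-t), the third ones B.
  set f : ℝ[X] := ∑ j ∈ Finset.range (n + 1), C (a j) * ((3 - X) ^ j * (1 + X) ^ (n - j)) with hf
  set A : ℝ[X] := (1 + X) ^ K * f with hA
  set B : ℝ[X] := ∑ j ∈ Finset.range (n + 1), C (a j * 2 ^ j * (-2) ^ (n + K - j)) * X ^ j with hB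
  have hle : ∀ j ∈ Finset.range (n + 1), j ≤ n := fun j hj => by
    have := Finset.mem_range.1 hj; omega
  have hAe : ∀ t : ℝ, A.eval t
      = ∑ j ∈ Finset.range (n + 1), a j * ((3 - t) ^ j * (1 + t) ^ (n + K - j)) := by
    intro t
    simp only [hA, hf, eval_mul, eval_pow, eval_add, eval_one, eval_X, eval_finsetSum, eval_C,
      eval_sub, eval_ofNat, Finset.mul_sum]
    refine Finset.sum_congr rfl fun j hj => ?_
    rw [show n + K - j = K + (n - j) by have := hle j hj; omega, pow_add]
    ring
  have hfd : f.natDegree ≤ n := by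
    refine natDegree_sum_le_of_forall_le _ _ fun j hj => ?_
    refine (natDegree_C_mul_le _ _).trans ?_
    have h1 : ((3 - X : ℝ[X]) ^ j).natDegree ≤ j := by
      have : (3 - X : ℝ[X]).natDegree ≤ 1 := by compute_degree
      simpa using natDegree_pow_le_of_le j this
    have h2 : ((1 + X : ℝ[X]) ^ (n - j)).natDegree ≤ n - j := by
      have : (1 + X : ℝ[X]).natDegree ≤ 1 := by compute_degree
      simpa using natDegree_pow_le_of_le (n - j) this
    have := natDegree_mul_le_of_le h1 h2
    have := hle j hj
    omega
  have hsum : A - A.comp (-X) + B = 0 := by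
    refine Polynomial.funext fun t => ?_
    rw [eval_zero, ← h t, eval_add, eval_sub, eval_comp, hAe, hAe, hB, eval_finsetSum,
      ← Finset.sum_sub_distrib, ← Finset.sum_add_distrib]
    refine Finset.sum_congr rfl fun j hj => ?_
    simp only [eval_neg, eval_X, eval_mul, eval_C, eval_pow, mul_pow]
    rw [sub_neg_eq_add, ← sub_eq_add_neg]
    ring
  have hBd : derivative^[n + 1] B = 0 := by
    refine iterate_derivative_eq_zero (Nat.lt_succ_of_le ?_)
    exact natDegree_sum_le_of_forall_le _ _ fun j hj => (natDegree_C_mul_X_pow_le _ _).trans (hle j hj)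
  set Q := derivative^[n + 1] A with hQ
  -- Order n + 1 exceeds deg B and is even, so B disappears and no sign arises from t ↦ -t.
  have hQeven : Q.comp (-X) = Q := by
    have h1 := congrArg (fun p => derivative^[n + 1] p) hsum
    simp only [iterate_map_add, iterate_derivative_sub, hBd,
      iterate_derivative_comp_neg_X, iterate_derivative_zero] at h1
    rw [(hn.add_odd odd_one).neg_one_pow, one_mul, add_zero, sub_eq_zero] at h1
    exact h1.symm
  have hQd1 : (1 + X : ℝ[X]) ^ (K - (n + 1)) ∣ Q :=
    pow_sub_dvd_iterate_derivative_of_pow_dvd (n + 1) (Dvd.intro f rfl)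
  have hQd2 : (1 - X : ℝ[X]) ^ (K - (n + 1)) ∣ Q := by
    obtain ⟨g, hg⟩ := hQd1
    refine ⟨g.comp (-X), ?_⟩
    rw [← hQeven, hg, mul_comp, pow_comp, add_comp, one_comp, X_comp, ← sub_eq_add_neg]
  have hcop : IsCoprime ((1 + X : ℝ[X]) ^ (K - (n + 1))) ((1 - X : ℝ[X]) ^ (K - (n + 1))) := by
    refine IsCoprime.pow ⟨C (1 / 2), C (1 / 2), ?_⟩
    rw [← mul_add, show (1 + X + (1 - X) : ℝ[X]) = C 2 by rw [C_ofNat]; ring, ← C_mul]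
    norm_num
  obtain ⟨l, hl⟩ := hcop.mul_dvd hQd1 hQd2
  have hQdeg : Q.natDegree ≤ K - 1 := by
    refine (natDegree_iterate_derivative _ _).trans ?_
    have h1 : ((1 + X : ℝ[X]) ^ K).natDegree ≤ K := by
      have : (1 + X : ℝ[X]).natDegree ≤ 1 := by compute_degree
      simpa using natDegree_pow_le_of_le K this
    have : A.natDegree ≤ K + n := natDegree_mul_le_of_le h1 hfd
    omega
  have hd1 : (1 + X : ℝ[X]).natDegree = 1 := by compute_degree!
  have hd2 : (1 - X : ℝ[X]).natDegree = 1 := by compute_degree!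
  have hne1 : (1 + X : ℝ[X]) ≠ 0 := fun h0 => by simp [h0] at hd1
  have hne2 : (1 - X : ℝ[X]) ≠ 0 := fun h0 => by simp [h0] at hd2
  have hldeg : l ≠ 0 → 2 * (K - (n + 1)) + l.natDegree ≤ K - 1 := by
    intro hl0
    rw [hl, natDegree_mul (mul_ne_zero (pow_ne_zero _ hne1) (pow_ne_zero _ hne2)) hl0,
      natDegree_mul (pow_ne_zero _ hne1) (pow_ne_zero _ hne2), natDegree_pow, natDegree_pow,
      hd1, hd2] at hQdeg
    omega
  have hnpos := hn.pos
  -- A nonzero quotient l has degree at most 2n + 1 - K. This is impossible for K ≥ 2n + 2; for K =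
  -- 2n it leaves degree at most 1, and evenness removes the linear term. For K = 2n + 1 the
  -- exponent would be the odd number n and the sign would change.
  obtain ⟨c, hc⟩ : ∃ c : ℝ, ∀ x, Q.eval x = c * ((1 + x) * (1 - x)) ^ (n - 1) := by
    by_cases hl0 : l = 0
    · exact ⟨0, fun x => by rw [hl, hl0]; simp⟩
    have hKn : K = 2 * n := by
      rcases hK with hK | hK
      · exact hK
      · have := hldeg hl0; omega
    have hl1 := hldeg hl0
    have hKe : K - (n + 1) = n - 1 := by omega
    have hl1' : l.natDegree ≤ 1 := by omega
    obtain ⟨p, q, hpq⟩ := exists_eq_X_add_C_of_natDegree_le_one hl1'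
    have hev : l.comp (-X) = l := by
      refine mul_left_cancel₀
        (mul_ne_zero (pow_ne_zero (K - (n + 1)) hne1) (pow_ne_zero (K - (n + 1)) hne2)) ?_
      rw [← hl]
      refine Eq.trans ?_ hQeven
      rw [hl]
      simp only [mul_comp, pow_comp, add_comp, sub_comp, one_comp, X_comp]
      rw [sub_neg_eq_add, ← sub_eq_add_neg]
      ring
    have hp0 : p = 0 := by
      have h1 := congrArg (eval 1) hev
      rw [hpq] at h1
      simp at h1
      linarith
    refine ⟨q, fun x => ?_⟩
    rw [hl, hpq, hp0, hKe]
    simp [mul_pow]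
    ring
  have hvan : ∀ i ≤ n, (derivative^[i] A).eval (-1) = 0 := by
    intro i hi
    obtain ⟨g, hg⟩ := pow_sub_dvd_iterate_derivative_of_pow_dvd (p := A) (q := 1 + X) i
      (Dvd.intro f rfl)
    rw [hg, eval_mul, eval_pow]
    simp [show K - i ≠ 0 by omega]
  -- Only odd j occur, so every term contains the factor 3 - t.
  have hA3 : A.eval 3 = 0 := by
    rw [hAe]
    refine Finset.sum_eq_zero fun j _ => ?_
    by_cases hj : Odd j
    · simp [hj.pos.ne']
    · simp [ha j hj]
  have hsq : ∀ x : ℝ, 0 ≤ ((1 + x) * (1 - x)) ^ (n - 1) := fun x =>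
    (Nat.Odd.sub_odd hn odd_one).pow_nonneg _
  have hA0 : A = 0 := by
    rcases le_total 0 c with hc0 | hc0
    · refine eq_zero_of_iterate_derivative_nonneg (a := -1) (b := 3) (n := n) (by norm_num)
        hvan hA3 fun x _ => ?_
      rw [hc]
      exact mul_nonneg hc0 (hsq x)
    · rw [← neg_eq_zero]
      refine eq_zero_of_iterate_derivative_nonneg (a := -1) (b := 3) (n := n) (by norm_num)
        (fun i hi => ?_) (by rw [eval_neg, hA3, neg_zero]) fun x _ => ?_
      · rw [iterate_derivative_neg, eval_neg, hvan i hi, neg_zero]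
      · rw [iterate_derivative_neg, eval_neg, hc, ← neg_mul]
        exact mul_nonneg (neg_nonneg.2 hc0) (hsq x)
  -- The substitution t = (3 - s)/(1 + s), for which (3 - t)/(1 + t) = s, turns A into G(s) times a
  -- power of 4/(1 + s).
  set G : ℝ[X] := ∑ j ∈ Finset.range (n + 1), C (a j) * X ^ j with hG
  have hG0 : G = 0 := by
    refine G.eq_zero_of_infinite_isRoot ((Set.Ioi_infinite (0 : ℝ)).mono fun s hs => ?_)
    have hs : (0 : ℝ) < s := hs
    have hs1 : 1 + s ≠ 0 := by positivity
    have h1 := hAe ((3 - s) / (1 + s))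
    rw [hA0, eval_zero] at h1
    have h2 : G.eval s * (4 / (1 + s)) ^ (n + K) = 0 := by
      rw [h1, hG, eval_finsetSum, Finset.sum_mul]
      refine Finset.sum_congr rfl fun j hj => ?_
      rw [show (3 - (3 - s) / (1 + s)) = s * (4 / (1 + s)) by field_simp; ring,
        show (1 + (3 - s) / (1 + s)) = 4 / (1 + s) by field_simp; ring, mul_pow, mul_assoc,
        ← pow_add, show j + (n + K - j) = n + K by have := hle j hj; omega]
      simp
      ring
    exact (mul_eq_zero.1 h2).resolve_right (pow_ne_zero _ (by positivity))
  intro j hj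
  have h1 := congrArg (fun p => coeff p j) hG0
  simpa [hG, finsetSum_coeff, coeff_C_mul, coeff_X_pow, Nat.lt_succ_of_le hj] using h1

/-! ### Leading coefficients of powers of D + λ and D + 2λ. -/

section PVA

variable {V : Type*} [CommRing V] [Algebra ℂ V] (D : Derivation ℂ V V)

theorem coeffD_coeff (p : V[X]) (n : ℕ) : (coeffD D p).coeff n = D (p.coeff n) := by
  have h : coeffD D p = p.sum fun k c => monomial k (D c) := rfl
  rw [h, sum_def, finsetSum_coeff]
  simp only [coeff_monomial, Finset.sum_ite_eq', mem_support_iff]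
  split_ifs with h0
  · rfl
  · rw [notMem_support_iff.1 h0, map_zero]

theorem addD_apply (q p : V[X]) : addD D q p = coeffD D p + q * p := rfl

theorem addD_natDegree_le {p : V[X]} {d : ℕ} (hp : p.natDegree ≤ d) :
    (addD D X p).natDegree ≤ d + 1 := by
  rw [natDegree_le_iff_coeff_eq_zero] at hp ⊢
  rintro (_ | k) hk
  · omega
  · rw [addD_apply, coeff_add, coeffD_coeff, coeff_X_mul, hp _ (by omega), hp _ (by omega),
      map_zero, add_zero]

theorem addD_coeff_succ {p : V[X]} {d : ℕ} (hp : p.natDegree ≤ d) :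
    (addD D X p).coeff (d + 1) = p.coeff d := by
  rw [addD_apply, coeff_add, coeffD_coeff, coeff_X_mul,
    coeff_eq_zero_of_natDegree_lt (Nat.lt_succ_of_le hp), map_zero, zero_add]

theorem addD_pow_natDegree_le {p : V[X]} {d : ℕ} (hp : p.natDegree ≤ d) (n : ℕ) :
    ((addD D X ^ n) p).natDegree ≤ d + n := by
  induction n with
  | zero => simpa using hp
  | succ n ih =>
    rw [pow_succ', Module.End.mul_apply]
    exact addD_natDegree_le D ih

theorem addD_pow_coeff {p : V[X]} {d : ℕ} (hp : p.natDegree ≤ d) (n : ℕ) :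
    ((addD D X ^ n) p).coeff (d + n) = p.coeff d := by
  induction n with
  | zero => simp
  | succ n ih =>
    rw [pow_succ', Module.End.mul_apply, ← ih]
    exact addD_coeff_succ D (addD_pow_natDegree_le D hp n)

theorem neg_addD_pow_apply (n : ℕ) (p : V[X]) :
    ((-addD D X) ^ n) p = C ((-1) ^ n) * (addD D X ^ n) p := by
  rcases n.even_or_odd with h | h
  · rw [h.neg_pow (addD D X), h.neg_one_pow, C_1, one_mul]
  · rw [h.neg_pow (addD D X), h.neg_one_pow, C_neg, C_1, neg_one_mul, LinearMap.neg_apply]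

/-- Binomial theorem for the commuting operators D and 2λ. For k > j the binomial coefficient is 0,
so the truncated j - k is harmless. -/
theorem addD_two_mul_X_pow_coeff (g : V) (j k : ℕ) :
    ((addD D (2 * X) ^ j) (C g)).coeff k = ((2 ^ k * j.choose k : ℕ) : V) * D^[j - k] g := by
  induction j generalizing k with
  | zero => rcases k with _ | k <;> simp [coeff_C]
  | succ j ih =>
    rw [pow_succ', Module.End.mul_apply, addD_apply, coeff_add, coeffD_coeff, ih,
      Derivation.leibniz, Derivation.map_natCast, smul_zero, add_zero, smul_eq_mul,
      mul_assoc (2 : V[X]), coeff_ofNat_mul]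
    rcases k with _ | k
    · rw [coeff_X_mul_zero, mul_zero, add_zero, Nat.sub_zero, Nat.sub_zero,
        Function.iterate_succ_apply']
      simp
    · rw [coeff_X_mul, ih, Nat.add_sub_add_right, Nat.choose_succ_succ]
      rcases Nat.lt_or_ge k j with h | h
      · rw [← Function.iterate_succ_apply' (f := D), show (j - (k + 1)).succ = j - k by omega]
        push_cast
        ring
      · rw [Nat.choose_eq_zero_of_lt (Nat.lt_succ_of_le h)]
        push_cast
        ring

end PVA

/-! ### Differential order and brackets with u. -/

namespace DifferentialFunctions

variable {V : Type*} [CommRing V] [IsDomain V] [Algebra ℂ V] [DifferentialFunctions V]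

theorem du_uvar (n k : ℕ) : du n (uvar V k) = if k = n then 1 else 0 := by
  rw [du, uvar, partialD_incl, MvPolynomial.pderiv_X, Pi.single_apply]
  by_cases h : k = n <;> simp [h]

theorem totalD_apply (g : V) :
    totalD V g = partialD (none : Option ℕ) g + ∑ n ∈ duSupport g, uvar V (n + 1) * du n g :=
  rfl

theorem du_totalD (n : ℕ) (g : V) :
    du n (totalD V g) = totalD V (du n g) + if n = 0 then 0 else du (n - 1) g := by
  have h0 : ∀ k, k ∉ duSupport g → du k g = 0 := fun k hk => by
    rwa [mem_duSupport, not_not] at hk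
  have hg := sum_duSupport g (duSupport g ∪ duSupport (du n g)) Finset.subset_union_left
  have hn := sum_duSupport (du n g) (duSupport g ∪ duSupport (du n g)) Finset.subset_union_right
  rw [totalD_apply, totalD_apply, hg, hn, map_add, map_sum, add_assoc]
  congr 1
  · exact partialD_comm _ _ _
  · simp only [Derivation.leibniz, smul_eq_mul, du_uvar, Finset.sum_add_distrib]
    congr 1
    · exact Finset.sum_congr rfl fun k _ => congrArg _ (partialD_comm _ _ _)
    · rcases n with _ | n
      · simp
      · simp only [add_left_inj, mul_ite, mul_one, mul_zero, Finset.sum_ite_eq',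
          Finset.mem_union, Nat.succ_ne_zero, if_false, Nat.add_sub_cancel]
        split_ifs with h
        · rfl
        · exact (h0 n fun hmem => h (Or.inl hmem)).symm

theorem du_iterate_totalD_eq_zero {g : V} {r : ℕ} (hg : ∀ n, r < n → du n g = 0) (i n : ℕ)
    (hn : r + i < n) : du n ((totalD V)^[i] g) = 0 := by
  induction i generalizing n with
  | zero => exact hg n hn
  | succ i ih =>
    rw [Function.iterate_succ_apply', du_totalD, ih n (by omega), map_zero, zero_add,
      if_neg (by omega), ih (n - 1) (by omega)]

/-- By [∂/∂u⁽ⁿ⁺¹⁾, D] = ∂/∂u⁽ⁿ⁾, each D raises the order bound by one and keeps the top partial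
derivative. -/
theorem du_iterate_totalD {g : V} {r : ℕ} (hg : ∀ n, r < n → du n g = 0) (i : ℕ) :
    du (r + i) ((totalD V)^[i] g) = du r g := by
  induction i with
  | zero => rfl
  | succ i ih =>
    rw [Function.iterate_succ_apply', du_totalD,
      du_iterate_totalD_eq_zero hg i _ (by omega), map_zero, zero_add, if_neg (by omega),
      ← ih]
    rfl

theorem IsQuasiconstant.iterate_totalD {g : V} (hg : IsQuasiconstant g) (i : ℕ) :
    IsQuasiconstant ((totalD V)^[i] g) := by
  induction i with
  | zero => exact hg
  | succ i ih =>
    intro n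
    rw [Function.iterate_succ_apply', du_totalD, ih n, map_zero, zero_add]
    split_ifs
    · rfl
    · exact ih _

theorem IsQuasiconstant.duSupport_eq {g : V} (hg : IsQuasiconstant g) : duSupport g = ∅ := by
  ext n
  simp [mem_duSupport, hg n]

theorem duSupport_uvar (k : ℕ) : duSupport (uvar V k) = {k} := by
  ext n
  rw [mem_duSupport, du_uvar, Finset.mem_singleton]
  by_cases h : k = n <;> simp [h, eq_comm]

theorem addD_totalD_pow_C_one (k : ℕ) : (addD (totalD V) X ^ k) (C 1) = X ^ k := by
  induction k with
  | zero => rfl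
  | succ k ih =>
    rw [pow_succ', Module.End.mul_apply, ih, addD_apply, pow_succ']
    convert zero_add _
    ext n
    rw [coeffD_coeff, coeff_X_pow]
    split_ifs <;> simp

theorem lambdaBracket_uvar_left (P : V[X]) (g : V) :
    lambdaBracket P (uvar V 0) g = ∑ n ∈ duSupport g, C (du n g) * (addD (totalD V) X ^ n) P := by
  rw [lambdaBracket, duSupport_uvar, Finset.sum_singleton]
  refine Finset.sum_congr rfl fun n _ => ?_
  rw [du_uvar, if_pos rfl, pow_zero, Module.End.one_apply]
  simp only [addD_totalD_pow_C_one]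
  rw [P.sum_C_mul_X_pow_eq]

theorem lambdaBracket_uvar_right (P : V[X]) (g : V) :
    lambdaBracket P g (uvar V 0) = ∑ m ∈ duSupport g, P.sum fun k h =>
      C h * (addD (totalD V) X ^ k) (((-addD (totalD V) X) ^ m) (C (du m g))) := by
  rw [lambdaBracket, duSupport_uvar]
  refine Finset.sum_congr rfl fun n _ => ?_
  rw [Finset.sum_singleton, du_uvar, if_pos rfl, C_1, one_mul, pow_zero, Module.End.one_apply]

/-- Only the term n = r reaches degree N + r, and D + λ preserves leading coefficients. -/
theorem lambdaBracket_uvar_left_coeff {P : V[X]} {N : ℕ} (hP : P.natDegree ≤ N) {g : V} {r : ℕ}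
    (hg : ∀ n, r < n → du n g = 0) :
    (lambdaBracket P (uvar V 0) g).coeff (N + r) = du r g * P.coeff N := by
  rw [lambdaBracket_uvar_left, finsetSum_coeff, Finset.sum_eq_single r]
  · rw [coeff_C_mul, addD_pow_coeff _ hP]
  · intro n hn hnr
    have h1 : n < r := by
      by_contra h
      exact (mem_duSupport g n).1 hn (hg n (by omega))
    rw [coeff_C_mul, coeff_eq_zero_of_natDegree_lt, mul_zero]
    exact (addD_pow_natDegree_le _ hP n).trans_lt (by omega)
  · intro h
    rw [mem_duSupport, not_not] at h
    rw [h, C_0, zero_mul, coeff_zero]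

/-- Only the top coefficient of P and the term m = r reach this degree; the sign comes from (-D -
λ)ʳ. -/
theorem lambdaBracket_uvar_right_coeff {P : V[X]} {N : ℕ} (hP : P.natDegree ≤ N) {g : V} {r : ℕ}
    (hg : ∀ n, r < n → du n g = 0) :
    (lambdaBracket P g (uvar V 0)).coeff (N + r) = (-1) ^ r * du r g * P.coeff N := by
  have hdeg : ∀ n, (C ((-1) ^ n) * (addD (totalD V) X ^ n) (C (du n g))).natDegree ≤ n := by
    intro n
    refine (natDegree_C_mul_le _ _).trans ?_
    simpa using addD_pow_natDegree_le (totalD V) (natDegree_C (du n g)).le n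
  rw [lambdaBracket_uvar_right, finsetSum_coeff, Finset.sum_eq_single r]
  · rw [P.sum_over_range' (fun n => by rw [C_0, zero_mul]) (N + 1) (by omega), finsetSum_coeff,
      Finset.sum_eq_single N]
    · rw [neg_addD_pow_apply, coeff_C_mul, add_comm N r, addD_pow_coeff _ (hdeg r), coeff_C_mul]
      have := addD_pow_coeff (totalD V) (natDegree_C (du r g)).le r
      rw [zero_add, coeff_C_zero] at this
      rw [this]
      ring
    · intro i hi hiN
      have := Finset.mem_range.1 hi
      rw [neg_addD_pow_apply, coeff_C_mul, coeff_eq_zero_of_natDegree_lt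
        ((addD_pow_natDegree_le _ (hdeg r) i).trans_lt (by omega)), mul_zero]
    · simp
  · intro n hn hnr
    have h1 : n < r := by
      by_contra h
      exact (mem_duSupport g n).1 hn (hg n (by omega))
    rw [P.sum_over_range' (fun n => by rw [C_0, zero_mul]) (N + 1) (by omega), finsetSum_coeff]
    refine Finset.sum_eq_zero fun i hi => ?_
    have := Finset.mem_range.1 hi
    rw [neg_addD_pow_apply, coeff_C_mul, coeff_eq_zero_of_natDegree_lt
      ((addD_pow_natDegree_le _ (hdeg n) i).trans_lt (by omega)), mul_zero]
  · intro h
    rw [mem_duSupport, not_not] at h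
    simp [h, sum_def]

/-! ### Coefficients of {u_λ u} and their top derivatives. -/

theorem mem_oddUpTo {N j : ℕ} : j ∈ oddUpTo N ↔ j ≤ N ∧ Odd j := by
  simp [oddUpTo]

theorem bracketUU_coeff (N : ℕ) (f : ℕ → V) (k : ℕ) :
    (bracketUU N f).coeff k
      = ∑ j ∈ oddUpTo N, ((2 ^ k * j.choose k : ℕ) : V) * (totalD V)^[j - k] (f j) := by
  rw [bracketUU, finsetSum_coeff]
  exact Finset.sum_congr rfl fun j _ => addD_two_mul_X_pow_coeff _ _ _ _

theorem bracketUU_natDegree_le (N : ℕ) (f : ℕ → V) : (bracketUU N f).natDegree ≤ N := by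
  rw [natDegree_le_iff_coeff_eq_zero]
  intro k hk
  rw [bracketUU_coeff]
  refine Finset.sum_eq_zero fun j hj => ?_
  rw [Nat.choose_eq_zero_of_lt ((mem_oddUpTo.1 hj).1.trans_lt hk)]
  simp

theorem bracketUU_coeff_self {N : ℕ} (hN : Odd N) (f : ℕ → V) :
    (bracketUU N f).coeff N = 2 ^ N * f N := by
  rw [bracketUU_coeff, Finset.sum_eq_single N]
  · simp
  · intro j hj hjN
    rw [Nat.choose_eq_zero_of_lt (lt_of_le_of_ne (mem_oddUpTo.1 hj).1 hjN)]
    simp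
  · exact fun h => absurd (mem_oddUpTo.2 ⟨le_rfl, hN⟩) h

/-- The derivative of `f_j` in the direction `u⁽ᵐ⁻ʲ⁾`, read as zero for `j > m`. -/
def symbolCoeff (m : ℕ) (f : ℕ → V) (j : ℕ) : V :=
  if j ≤ m then du (m - j) (f j) else 0

theorem du_bracketUU_coeff_eq_zero {N m : ℕ} {f : ℕ → V}
    (hf : ∀ j ∈ oddUpTo N, ∀ n, m < j + n → du n (f j) = 0) (k n : ℕ) (hn : m < k + n) :
    du n ((bracketUU N f).coeff k) = 0 := by
  rw [bracketUU_coeff, map_sum]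
  refine Finset.sum_eq_zero fun j hj => ?_
  rw [Derivation.leibniz, Derivation.map_natCast, smul_zero, add_zero, smul_eq_mul]
  rcases Nat.lt_or_ge j k with hjk | hjk
  · simp [Nat.choose_eq_zero_of_lt hjk]
  rcases Nat.lt_or_ge m j with hmj | hmj
  · have hq : IsQuasiconstant (f j) := fun i => hf j hj i (by omega)
    rw [hq.iterate_totalD, mul_zero]
  · rw [du_iterate_totalD_eq_zero (r := m - j) (fun i hi => hf j hj i (by omega)) _ _ (by omega),
      mul_zero]

/-- The k-th coefficient involves D^(j-k) f_j, whose order is at most (m - j) + (j - k) = m - k for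
every j. This is why the level weighs ord f_j by j: all f_j contribute to the same top derivative.
-/
theorem du_bracketUU_coeff {N m : ℕ} {f : ℕ → V}
    (hf : ∀ j ∈ oddUpTo N, ∀ n, m < j + n → du n (f j) = 0) (k : ℕ) (hk : k ≤ m) :
    du (m - k) ((bracketUU N f).coeff k)
      = ∑ j ∈ oddUpTo N, ((2 ^ k * j.choose k : ℕ) : V) * symbolCoeff m f j := by
  rw [bracketUU_coeff, map_sum]
  refine Finset.sum_congr rfl fun j hj => ?_
  rw [Derivation.leibniz, Derivation.map_natCast, smul_zero, add_zero, smul_eq_mul]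
  rcases Nat.lt_or_ge j k with hjk | hjk
  · simp [Nat.choose_eq_zero_of_lt hjk]
  rw [symbolCoeff]
  split_ifs with hmj
  · rw [show m - k = (m - j) + (j - k) by omega,
      du_iterate_totalD fun i hi => hf j hj i (by omega)]
  · have hq : IsQuasiconstant (f j) := fun i => hf j hj i (by omega)
    rw [hq.iterate_totalD]

theorem sum_choose_symbolCoeff_eq_zero {N m k : ℕ} (f : ℕ → V) (hk : m < k) :
    ∑ j ∈ oddUpTo N, ((2 ^ k * j.choose k : ℕ) : V) * symbolCoeff m f j = 0 := by
  refine Finset.sum_eq_zero fun j _ => ?_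
  rw [symbolCoeff]
  split_ifs with hj
  · simp [Nat.choose_eq_zero_of_lt (hj.trans_lt hk)]
  · rw [mul_zero]

/-- For k > m the coefficient is a quasiconstant and both sides vanish, so the statement needs no
bound on k. -/
theorem lambdaBracket_uvar_bracketUU_coeff {N m : ℕ} {f : ℕ → V}
    (hf : ∀ j ∈ oddUpTo N, ∀ n, m < j + n → du n (f j) = 0) (k : ℕ) :
    (lambdaBracket (bracketUU N f) (uvar V 0) ((bracketUU N f).coeff k)).coeff (N + m - k)
      = (∑ j ∈ oddUpTo N, ((2 ^ k * j.choose k : ℕ) : V) * symbolCoeff m f j)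
        * (bracketUU N f).coeff N := by
  have h0 := du_bracketUU_coeff_eq_zero hf k
  rcases Nat.lt_or_ge m k with hmk | hmk
  · have hq : IsQuasiconstant ((bracketUU N f).coeff k) := fun n => h0 n (by omega)
    rw [sum_choose_symbolCoeff_eq_zero f hmk, zero_mul, lambdaBracket_uvar_left, hq.duSupport_eq,
      Finset.sum_empty, coeff_zero]
  · rw [Nat.add_sub_assoc hmk, lambdaBracket_uvar_left_coeff (bracketUU_natDegree_le N f)
      (fun n hn => h0 n (by omega)), du_bracketUU_coeff hf k hmk]

theorem lambdaBracket_bracketUU_uvar_coeff {N m : ℕ} {f : ℕ → V} (hN : Odd N)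
    (hf : ∀ j ∈ oddUpTo N, ∀ n, m < j + n → du n (f j) = 0) (k : ℕ) :
    (lambdaBracket (bracketUU N f) ((bracketUU N f).coeff k) (uvar V 0)).coeff (N + m - k)
      = -((-1) ^ (N + m - k)
        * (∑ j ∈ oddUpTo N, ((2 ^ k * j.choose k : ℕ) : V) * symbolCoeff m f j)
        * (bracketUU N f).coeff N) := by
  have h0 := du_bracketUU_coeff_eq_zero hf k
  rcases Nat.lt_or_ge m k with hmk | hmk
  · have hq : IsQuasiconstant ((bracketUU N f).coeff k) := fun n => h0 n (by omega)
    rw [sum_choose_symbolCoeff_eq_zero f hmk, mul_zero, zero_mul, neg_zero,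
      lambdaBracket_uvar_right, hq.duSupport_eq, Finset.sum_empty, coeff_zero]
  · rw [Nat.add_sub_assoc hmk, lambdaBracket_uvar_right_coeff (bracketUU_natDegree_le N f)
      (fun n hn => h0 n (by omega)), du_bracketUU_coeff hf k hmk, pow_add, hN.neg_one_pow]
    ring

end DifferentialFunctions

/-! ### The leading part of the Jacobi identity. -/

/-- Resums the leading coefficients over k into the symbol of (D + 2λ)ʲ; the range N is common to
all j since terms with k > j vanish. -/
theorem Finset.sum_range_two_pow_mul_choose {R : Type*} [CommRing R] (x y : R) {j N M : ℕ}
    (hjN : j ≤ N) (hjM : j ≤ M) :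
    ∑ k ∈ Finset.range (N + 1), ((2 ^ k * j.choose k : ℕ) : R) * (x ^ k * y ^ (M - k))
      = (y + 2 * x) ^ j * y ^ (M - j) := by
  rw [← Finset.sum_subset (Finset.range_mono (Nat.succ_le_succ hjN)), add_comm y, add_pow,
    Finset.sum_mul]
  · refine Finset.sum_congr rfl fun k hk => ?_
    have := Finset.mem_range.1 hk
    rw [show M - k = (j - k) + (M - j) by omega, pow_add, mul_pow]
    push_cast
    ring
  · intro k _ hk
    rw [Finset.mem_range, not_lt] at hk
    simp [Nat.choose_eq_zero_of_lt hk]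

section

variable {V : Type*} [CommRing V]

/-- The substitution `λ ↦ α T`, `μ ↦ β T` on `V[λ][μ]`. -/
noncomputable def Polynomial.substLine (α β : V) : V[X][X] →+* V[X] :=
  eval₂RingHom (compRingHom (C α * X)) (C β * X)

theorem Polynomial.substLine_X (α β : V) : substLine α β X = C β * X := by
  simp [substLine]

theorem Polynomial.substLine_C_X (α β : V) : substLine α β (C X) = C α * X := by
  simp [substLine]

theorem Polynomial.substLine_aeval (α β : V) (x : V[X][X]) (q : V[X]) :
    substLine α β (aeval x q) = q.comp (substLine α β x) := by
  rw [aeval_def, hom_eval₂, comp]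
  congr 1
  ext a
  simp [substLine]

theorem Polynomial.coeff_pow_mul_comp_C_mul_X (α β : V) (q : V[X]) {k d : ℕ} (hk : k ≤ d) :
    ((C β * X) ^ k * q.comp (C α * X)).coeff d = β ^ k * α ^ (d - k) * q.coeff (d - k) := by
  rw [mul_pow, ← C_pow, mul_assoc, coeff_C_mul, coeff_X_pow_mul', if_pos hk,
    comp_C_mul_X_coeff]
  ring

end

namespace DifferentialFunctions

variable {V : Type*} [CommRing V] [IsDomain V] [Algebra ℂ V] [DifferentialFunctions V]

theorem lambdaBracket_zero_right (P : V[X]) (a : V) : lambdaBracket P a 0 = 0 := by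
  simp [lambdaBracket, IsQuasiconstant.duSupport_eq (g := (0 : V)) fun n => map_zero _]

theorem lambdaBracket_zero_left (P : V[X]) (a : V) : lambdaBracket P 0 a = 0 := by
  simp [lambdaBracket, IsQuasiconstant.duSupport_eq (g := (0 : V)) fun n => map_zero _]

/-- The leading part of the Jacobi identity for `u, u, u`. -/
theorem sum_symbolCoeff_mul_eq_zero {N m : ℕ} {f : ℕ → V} (hN : Odd N) (hfN : f N ≠ 0)
    (hP : IsPoissonLambdaBracket (totalD V) (lambdaBracket (bracketUU N f)))
    (hf : ∀ j ∈ oddUpTo N, ∀ n, m < j + n → du n (f j) = 0) (α β : V) :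
    ∑ j ∈ oddUpTo N, symbolCoeff m f j * ((α + 2 * β) ^ j * α ^ (N + m - j)
      - (β + 2 * α) ^ j * β ^ (N + m - j) + (α - β) ^ j * (-(α + β)) ^ (N + m - j)) = 0 := by
  set P := bracketUU N f with hPdef
  have hPN : P.coeff N ≠ 0 := by
    have : CharZero V := charZero_of_injective_algebraMap (algebraMap ℂ V).injective
    rw [hPdef, bracketUU_coeff_self hN]
    exact mul_ne_zero (pow_ne_zero _ two_ne_zero) hfN
  have huu : lambdaBracket P (uvar V 0) (uvar V 0) = P := by
    rw [lambdaBracket_uvar_left, duSupport_uvar, Finset.sum_singleton, du_uvar, if_pos rfl]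
    simp
  have hJ := hP.jacobi (uvar V 0) (uvar V 0) (uvar V 0)
  have hlt : P.natDegree < N + 1 := Nat.lt_succ_of_le (bracketUU_natDegree_le N f)
  rw [huu, P.sum_over_range' (by simp [lambdaBracket_zero_right]) _ hlt,
    P.sum_over_range' (by simp [lambdaBracket_zero_right]) _ hlt,
    P.sum_over_range' (by simp [lambdaBracket_zero_left]) _ hlt] at hJ
  -- On the line λ = αT, μ = βT, the coefficient of T^(N+m) is the homogeneous part of degree N + m
  -- at (α, β).
  have hJ := congrArg (fun p => (substLine α β p).coeff (N + m)) hJ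
  simp only [map_sub, map_sum, map_mul, map_pow, map_add, substLine_aeval, substLine_X,
    substLine_C_X, coeff_sub, finsetSum_coeff] at hJ
  rw [← add_mul, ← C_add] at hJ
  have e1 : ∀ x y : V, ∑ k ∈ Finset.range (N + 1), ((C x * X) ^ k *
        (lambdaBracket P (uvar V 0) (P.coeff k)).comp (C y * X)).coeff (N + m)
      = P.coeff N * ∑ j ∈ oddUpTo N, symbolCoeff m f j
        * ((y + 2 * x) ^ j * y ^ (N + m - j)) := by
    intro x y
    have : ∀ j ∈ oddUpTo N, symbolCoeff m f j * ((y + 2 * x) ^ j * y ^ (N + m - j))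
        = ∑ k ∈ Finset.range (N + 1), symbolCoeff m f j
          * (((2 ^ k * j.choose k : ℕ) : V) * (x ^ k * y ^ (N + m - k))) := by
      intro j hj
      have := (mem_oddUpTo.1 hj).1
      rw [← Finset.sum_range_two_pow_mul_choose x y this (by omega : j ≤ N + m), Finset.mul_sum]
    rw [Finset.sum_congr rfl this, Finset.sum_comm, Finset.mul_sum]
    refine Finset.sum_congr rfl fun k hk => ?_
    have := Finset.mem_range.1 hk
    rw [coeff_pow_mul_comp_C_mul_X _ _ _ (by omega), lambdaBracket_uvar_bracketUU_coeff hf,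
      ← hPdef, Finset.sum_mul, Finset.mul_sum, Finset.mul_sum]
    exact Finset.sum_congr rfl fun j _ => by ring
  -- To leading order, exchanging the arguments of the bracket negates it and replaces y by -y; with
  -- y = α + β this produces ν = -(α + β).
  have e2 : ∀ x y : V, ∑ k ∈ Finset.range (N + 1), ((C x * X) ^ k *
        (lambdaBracket P (P.coeff k) (uvar V 0)).comp (C y * X)).coeff (N + m)
      = -(P.coeff N * ∑ j ∈ oddUpTo N, symbolCoeff m f j
        * ((-y + 2 * x) ^ j * (-y) ^ (N + m - j))) := by
    intro x y
    rw [← e1, ← Finset.sum_neg_distrib]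
    refine Finset.sum_congr rfl fun k hk => ?_
    have := Finset.mem_range.1 hk
    rw [coeff_pow_mul_comp_C_mul_X _ _ _ (by omega), coeff_pow_mul_comp_C_mul_X _ _ _ (by omega),
      lambdaBracket_uvar_bracketUU_coeff hf, lambdaBracket_bracketUU_uvar_coeff hN hf,
      neg_pow y]
    ring
  rw [e1, e1, e2] at hJ
  refine (mul_eq_zero.1 ?_).resolve_left hPN
  rw [show -(α + β) + 2 * α = α - β by ring] at hJ
  simp only [mul_add, mul_sub, Finset.sum_add_distrib, Finset.sum_sub_distrib] at hJ ⊢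
  linear_combination hJ

/-- If `n` and `K` are the smaller and the larger of `N` and `m`, or `m - 1` and `N + 1` for even
`m < N`, then the leading coefficients all vanish for `K = 2 n` and for `K ≥ 2 n + 2`. -/
theorem symbolCoeff_eq_zero {N m n K : ℕ} {f : ℕ → V} (hN : Odd N) (hfN : f N ≠ 0)
    (hP : IsPoissonLambdaBracket (totalD V) (lambdaBracket (bracketUU N f)))
    (hf : ∀ j ∈ oddUpTo N, ∀ n, m < j + n → du n (f j) = 0)
    (hn : Odd n) (hnK : n + K = N + m) (hnN : n ≤ N)
    (hjn : ∀ j, Odd j → j ≤ N → j ≤ m → j ≤ n)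
    (hK : K = 2 * n ∨ 2 * n + 2 ≤ K) {j : ℕ} (hj : j ∈ oddUpTo N) : symbolCoeff m f j = 0 := by
  -- Real functionals separate the points of V, which reduces the claim to real coefficients.
  rw [← Module.forall_dual_apply_eq_zero_iff ℝ]
  intro φ
  by_cases hjm : j ≤ m
  swap
  · rw [symbolCoeff, if_neg hjm, map_zero]
  have hjN := mem_oddUpTo.1 hj
  have key := eq_zero_of_cyclic_sum_eq_zero hn hK
    (fun i => if Odd i then φ (symbolCoeff m f i) else 0) (fun i hi => if_neg hi) ?_ j
      (hjn j hjN.2 hjN.1 hjm)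
  · simpa only [if_pos hjN.2] using key
  intro t
  have h := congrArg φ (sum_symbolCoeff_mul_eq_zero hN hfN hP hf
    (algebraMap ℝ V (1 + t)) (algebraMap ℝ V (1 - t)))
  rw [map_zero, map_sum] at h
  refine Eq.trans ?_ h
  rw [hnK]
  have hsub : (Finset.range (n + 1)).filter Odd ⊆ oddUpTo N := fun i hi => by
    simp only [Finset.mem_filter, Finset.mem_range] at hi
    exact mem_oddUpTo.2 ⟨by omega, hi.2⟩
  rw [← Finset.sum_subset hsub, Finset.sum_filter]
  · refine Finset.sum_congr rfl fun i _ => ?_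
    split_ifs
    · rw [← map_ofNat (algebraMap ℝ V) 2]
      simp only [← map_mul, ← map_add, ← map_sub, ← map_neg, ← map_pow]
      rw [mul_comm (symbolCoeff m f i), ← Algebra.smul_def, map_smul, smul_eq_mul, mul_comm]
      congr 1
      ring_nf
    · rw [zero_mul]
  -- An odd i ≤ N beyond n exceeds m, where the leading coefficient is 0 by convention.
  · intro i hi hin
    have hi := mem_oddUpTo.1 hi
    simp only [Finset.mem_filter, Finset.mem_range, not_and_or] at hin
    have : ¬ i ≤ m := fun him => by
      have := hjn i hi.2 hi.1 him
      rcases hin with h | h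
      · omega
      · exact h hi.2
    rw [symbolCoeff, if_neg this, zero_mul, map_zero]

/-- An index attaining the maximum is not a quasiconstant, since those contribute ⊥; its top
derivative is the required nonzero one. -/
theorem exists_level_eq {N : ℕ} {f : ℕ → V} (hq : ¬ ∀ j ∈ oddUpTo N, IsQuasiconstant (f j)) :
    ∃ m : ℕ, level N f = (m : WithBot ℕ) ∧
      (∀ j ∈ oddUpTo N, ∀ n, m < j + n → du n (f j) = 0) ∧
      ∃ j ∈ oddUpTo N, symbolCoeff m f j ≠ 0 := by
  obtain ⟨i, hi, hiq⟩ : ∃ j ∈ oddUpTo N, ¬ IsQuasiconstant (f j) := by push Not at hq; exact hq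
  obtain ⟨j, hj, hjmax⟩ := Finset.exists_mem_eq_sup (oddUpTo N) ⟨i, hi⟩
    fun j : ℕ => (j : WithBot ℕ) + ord (f j)
  have hle : ∀ k ∈ oddUpTo N, ∀ n, du n (f k) ≠ 0 → ((k + n : ℕ) : WithBot ℕ) ≤ level N f := by
    intro k hk n hn
    refine le_trans ?_ (Finset.le_sup (f := fun j : ℕ => (j : WithBot ℕ) + ord (f j)) hk)
    rw [Nat.cast_add]
    exact add_le_add_right (Finset.le_max ((mem_duSupport _ _).2 hn)) _
  obtain ⟨n, hn⟩ : ∃ n, du n (f i) ≠ 0 := by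
    by_contra h
    push Not at h
    exact hiq h
  have hbot : (j : WithBot ℕ) + ord (f j) ≠ ⊥ := by
    intro h
    have := hle i hi n hn
    rw [level, hjmax, h] at this
    exact absurd this (by simp)
  obtain ⟨r, hr⟩ : ∃ r : ℕ, ord (f j) = r := by
    cases h : ord (f j) with
    | bot => exact absurd (by rw [h, WithBot.add_bot]) hbot
    | coe r => exact ⟨r, rfl⟩
  have hlev : level N f = ((j + r : ℕ) : WithBot ℕ) := by
    rw [level, hjmax, hr, Nat.cast_add]
  refine ⟨j + r, hlev, fun k hk n hkn => ?_, j, hj, ?_⟩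
  · by_contra h
    have := hle k hk n h
    rw [hlev, Nat.cast_le] at this
    omega
  · rw [symbolCoeff, if_pos (Nat.le_add_right _ _), Nat.add_sub_cancel_left, ← mem_duSupport]
    exact Finset.mem_of_max hr

end DifferentialFunctions

/-! ### Numerical constraints on the level. -/

open DifferentialFunctions in
theorem theorem0p1 {V : Type*} [CommRing V] [IsDomain V] [Algebra ℂ V] [DifferentialFunctions V]
    (N : ℕ) (hN : Odd N) (f : ℕ → V) (hfN : f N ≠ 0)
    (hP : IsPoissonLambdaBracket (totalD V) (lambdaBracket (bracketUU N f)))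
    (hq : ¬ ∀ j ∈ oddUpTo N, IsQuasiconstant (f j)) :
    ∃ m : ℕ, level N f = (m : WithBot ℕ) ∧
      ((N : ℚ) - 1) / 2 ≤ (m : ℚ) ∧ m ≤ 2 * N + 1 ∧ m ≠ 2 * N ∧
      ((N : ℤ) ≡ -1 [ZMOD 4] → (m : ℚ) ≠ ((N : ℚ) + 1) / 2) ∧
      ((N : ℤ) ≡ 1 [ZMOD 4] →
        (m : ℚ) ≠ ((N : ℚ) - 1) / 2 ∧ (m : ℚ) ≠ ((N : ℚ) + 3) / 2) := by
  obtain ⟨m, hm, hf, j, hj, hj0⟩ := exists_level_eq hq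
  have hjm : j ≤ m := by
    by_contra h
    exact hj0 (if_neg h)
  have hjpos := (mem_oddUpTo.1 hj).2.pos
  have hcase : ∀ n K : ℕ, Odd n → n + K = N + m → n ≤ N →
      (∀ j, Odd j → j ≤ N → j ≤ m → j ≤ n) → ¬ (K = 2 * n ∨ 2 * n + 2 ≤ K) :=
    fun n K hn hnK hnN hjn hK => hj0 (symbolCoeff_eq_zero hN hfN hP hf hn hnK hnN hjn hK hj)
  have hlarge : ¬ (m = 2 * N ∨ 2 * N + 2 ≤ m) := hcase N m hN rfl le_rfl fun _ _ h _ => h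
  have hodd : Odd m → m < N → ¬ (N = 2 * m ∨ 2 * m + 2 ≤ N) := fun h hmN =>
    hcase m N h (add_comm _ _) hmN.le fun _ _ _ h => h
  -- For even m the odd j ≤ m are at most m - 1, so one more factor splits off. This excludes 2m = N
  -- + 3 and 2m ≤ N + 1, the source of the conditions modulo 4.
  have heven : Even m → m < N → ¬ (N + 1 = 2 * (m - 1) ∨ 2 * (m - 1) + 2 ≤ N + 1) := by
    intro h hmN
    refine hcase (m - 1) (N + 1) (Nat.Even.sub_odd (by omega) h odd_one) (by omega) (by omega) ?_
    intro i hi _ him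
    rcases him.lt_or_eq with h1 | rfl
    · omega
    · exact absurd h (Nat.not_even_iff_odd.2 hi)
  rw [Nat.odd_iff] at hodd hN
  rw [Nat.even_iff] at heven
  have hhalf : N ≤ 2 * m + 1 := by omega
  refine ⟨m, hm, ?_, by omega, by omega, fun h4 h => ?_, fun h4 => ⟨fun h => ?_, fun h => ?_⟩⟩
  · have : (N : ℚ) ≤ 2 * m + 1 := by exact_mod_cast hhalf
    linarith
  · have h' : 2 * m = N + 1 := by
      have : (2 * m : ℚ) = N + 1 := by linarith
      exact_mod_cast this
    have := h4.eq
    omega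
  · have h' : 2 * m + 1 = N := by
      have : (2 * m + 1 : ℚ) = N := by linarith
      exact_mod_cast this
    have := h4.eq
    omega
  · have h' : 2 * m = N + 3 := by
      have : (2 * m : ℚ) = N + 3 := by linarith
      exact_mod_cast this
    have := h4.eq
    omega
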